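/- Let $M$ be a metric space with a base point $p\in M$. Let $\mathrm{Lip}_0(M)$ be the Banach space of all Lipschitz functions $f\colon M\to\mathbb R$ with $f(p)=0$, normed by the Lipschitz constant, and let $\mathcal F(M)=\overline{\mathrm{span}}\{\delta_x\colon x\in M\}\subseteq \mathrm{Lip}_0(M)^*$, where $\delta_x(f)=f(x)$; this is the canonical predual of $\mathrm{Lip}_0(M)$. For a real nontrivial Banach space $X$ with closed unit ball $B_X$, a slice of $B_X$ is a set $\{x\in B_X\colon x^*(x)>1-\alpha\}$ with $x^*\in X^*$, $\|x^*\|=1$, $\alpha>0$. For $X=\mathrm{Lip}_0(M)$ it is a weak$^*$ slice if it is given by such an $x^*\in\mathcal F(M)$. The space $X$ has * the D2P if every nonempty relatively weakly open subset of $B_X$ has diameter $2$; * the SD2P if $\sum_{i=1}^n\lambda_iS_i$ has diameter $2$ whenever $n\ge1$, $\lambda_i\ge0$, $\sum_{i=1}^n\lambda_i=1$, and $S_1,\dots,S_n$ are slices of $B_X$; * the SSD2P if for every $n\ge1$, all slices $S_1,\dots,S_n$ of $B_X$ and every $\varepsilon>0$ there are $f_i\in S_i$ ($i=1,\dots,n$)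 and $g\in B_X$ with $\|g\|>1-\varepsilon$ such that $f_i\pm g\in S_i$ for all $i$. The $w^*$-SD2P and the $w^*$-SSD2P of $\mathrm{Lip}_0(M)$ are defined in the same way with weak$^*$ slices in place of slices. **Theorem.** The SSD2P, the SD2P and the D2P are three different properties for the spaces $\mathrm{Lip}_0(M)$; in fact, the SD2P differs from the $w^*$-SSD2P, and the D2P differs from the $w^*$-SD2P. More precisely: 1. Let $M=\{a_1,a_2,b_1,b_2\}\cup\{u_m,v_m\colon m\in\mathbb N\}$ (all listed points distinct), with $d(a_i,b_j)=d(a_i,u_m)=d(b_i,v_m)=d(u_m,v_m)=1$ for all $i,j\in\{1,2\}$, $m\in\mathbb N$, and with all other distances between distinct points equal to $2$. Then, for every choice of the base point, $\mathrm{Lip}_0(M)$ has the SD2P, but neither the $w^*$-SSD2P nor the SSD2P. 2. Let $M=\{a_i,u^i_m,v^i_m\colon i\in\{1,2,3\},\,m\in\mathbb N\}$ (all listed points distinct), with $d(a_i,u^j_m)=d(a_i,v^j_m)=1$ for all $i\ne j$ and $m\in\mathbb N$, with $d(u^j_m,v^j_m)=1$ for all $j$ and $m$, and with all other distances between distinct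 points equal to $2$. Then, for every choice of the base point, $\mathrm{Lip}_0(M)$ has the D2P, but neither the $w^*$-SD2P, nor the SD2P, nor the SSD2P. -/

import Mathlib

noncomputable section

namespace LipDiam

/-! ### Diameter two properties of a real normed space -/

section DiameterTwo

variable {X : Type*} [NormedAddCommGroup X] [NormedSpace ℝ X]

/-- The set `S(φ, α) = {x ∈ B_X : φ x > 1 - α}`. It is a slice when `‖φ‖ = 1` and `α > 0`. -/
def slice (φ : StrongDual ℝ X) (α : ℝ) : Set X :=
  {x | x ∈ Metric.closedBall (0 : X) 1 ∧ 1 - α < φ x}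

/-- `S` is a slice of the closed unit ball of `X` whose defining norm-one functional belongs to
`Z ⊆ X*`. With `Z = X*` these are all slices; when `X` is a dual space and `Z` is the canonical
image of its predual in `X*`, these are the weak* slices. -/
def IsSlice (Z : Set (StrongDual ℝ X)) (S : Set X) : Prop :=
  ∃ φ ∈ Z, ‖φ‖ = 1 ∧ ∃ α : ℝ, 0 < α ∧ S = slice φ α

/-- The convex combination `∑ i, w i • S i` of the sets `S i`. -/
def convComb {n : ℕ} (w : Fin n → ℝ) (S : Fin n → Set X) : Set X :=
  {x | ∃ y : Fin n → X, (∀ i, y i ∈ S i) ∧ x = ∑ i, w i • y i}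

/-- Every convex combination of slices defined by functionals in `Z` has diameter 2. -/
def SD2PFor (Z : Set (StrongDual ℝ X)) : Prop :=
  ∀ (n : ℕ) (w : Fin n → ℝ) (S : Fin n → Set X),
    (∀ i, 0 ≤ w i) → ∑ i, w i = 1 → (∀ i, IsSlice Z (S i)) →
      Metric.diam (convComb w S) = 2

/-- For finitely many (at least one) slices `S i` defined by functionals in `Z` and `ε > 0` there
are `f i ∈ S i` and `g` in the unit ball with `‖g‖ > 1 - ε` and `f i ± g ∈ S i` for all `i`. -/
def SSD2PFor (Z : Set (StrongDual ℝ X)) : Prop :=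
  ∀ (n : ℕ) (S : Fin n → Set X), 0 < n → (∀ i, IsSlice Z (S i)) → ∀ ε : ℝ, 0 < ε →
    ∃ (f : Fin n → X) (g : X), (∀ i, f i ∈ S i) ∧ g ∈ Metric.closedBall (0 : X) 1 ∧
      1 - ε < ‖g‖ ∧ ∀ i, f i + g ∈ S i ∧ f i - g ∈ S i

variable (X)

/-- The diameter 2 property: every nonempty relatively weakly open subset of the closed unit ball
has diameter 2. -/
def HasD2P : Prop :=
  ∀ U : Set (WeakSpace ℝ X), IsOpen U →
    (Metric.closedBall (0 : X) 1 ∩ toWeakSpace ℝ X ⁻¹' U).Nonempty →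
      Metric.diam (Metric.closedBall (0 : X) 1 ∩ toWeakSpace ℝ X ⁻¹' U) = 2

/-- The strong diameter 2 property. -/
def HasSD2P : Prop := SD2PFor (Set.univ : Set (StrongDual ℝ X))

/-- The symmetric strong diameter 2 property. -/
def HasSSD2P : Prop := SSD2PFor (Set.univ : Set (StrongDual ℝ X))

end DiameterTwo

/-! ### The space of Lipschitz functions vanishing at the base point -/

section Lip0

variable (M : Type*) [MetricSpace M] (p : M)

/-- The real Lipschitz functions on `M` vanishing at `p`, as a subspace of `M → ℝ`. -/
def lip0Submodule : Submodule ℝ (M → ℝ) where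
  carrier := {f | f p = 0 ∧ ∃ K, LipschitzWith K f}
  zero_mem' := ⟨rfl, 0, LipschitzWith.const 0⟩
  add_mem' := by
    rintro f g ⟨hf, K, hK⟩ ⟨hg, L, hL⟩
    exact ⟨by simp [hf, hg], K + L, hK.add hL⟩
  smul_mem' := by
    rintro c f ⟨hf, K, hK⟩
    refine ⟨by simp [hf], ‖c‖₊ * K, LipschitzWith.of_dist_le_mul fun x y => ?_⟩
    have h := hK.dist_le_mul x y
    simp only [Pi.smul_apply, smul_eq_mul, Real.dist_eq, ← mul_sub, abs_mul, NNReal.coe_mul,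
      coe_nnnorm, Real.norm_eq_abs] at h ⊢
    rw [mul_assoc]
    exact mul_le_mul_of_nonneg_left h (abs_nonneg c)

/-- The space `Lip_0(M)` of the metric space `M` pointed at `p`. -/
def Lip0 : Type _ := lip0Submodule M p

variable {M p}

namespace Lip0

instance : AddCommGroup (Lip0 M p) := inferInstanceAs (AddCommGroup (lip0Submodule M p))

instance : Module ℝ (Lip0 M p) := inferInstanceAs (Module ℝ (lip0Submodule M p))

instance : CoeFun (Lip0 M p) (fun _ => M → ℝ) := ⟨Subtype.val⟩

theorem add_apply (f g : Lip0 M p) (x : M) : (f + g) x = f x + g x := rfl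

theorem smul_apply (c : ℝ) (f : Lip0 M p) (x : M) : (c • f) x = c * f x := rfl

theorem zero_apply (x : M) : (0 : Lip0 M p) x = 0 := rfl

theorem base_apply (f : Lip0 M p) : f p = 0 := f.2.1

/-- The difference quotients of `f`. -/
def quotients (f : Lip0 M p) : Set ℝ :=
  {r | ∃ x y : M, x ≠ y ∧ r = |f x - f y| / dist x y}

/-- The norm of `f` is its Lipschitz constant, the supremum of its difference quotients. -/
instance : Norm (Lip0 M p) := ⟨fun f => sSup (quotients f)⟩

theorem norm_def (f : Lip0 M p) : ‖f‖ = sSup (quotients f) := rfl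

theorem bddAbove_quotients (f : Lip0 M p) : BddAbove (quotients f) := by
  obtain ⟨K, hK⟩ := f.2.2
  refine ⟨K, ?_⟩
  rintro r ⟨x, y, hxy, rfl⟩
  rw [div_le_iff₀ (dist_pos.2 hxy)]
  exact hK.dist_le_mul x y

theorem norm_nonneg' (f : Lip0 M p) : 0 ≤ ‖f‖ := by
  apply Real.sSup_nonneg
  rintro r ⟨x, y, -, rfl⟩
  positivity

theorem abs_sub_le (f : Lip0 M p) (x y : M) : |f x - f y| ≤ ‖f‖ * dist x y := by
  by_cases h : x = y
  · simp [h]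
  · rw [← div_le_iff₀ (dist_pos.2 h)]
    exact le_csSup (bddAbove_quotients f) ⟨x, y, h, rfl⟩

theorem norm_le_of_abs_sub_le (f : Lip0 M p) {C : ℝ} (hC : 0 ≤ C)
    (h : ∀ x y : M, |f x - f y| ≤ C * dist x y) : ‖f‖ ≤ C := by
  refine Real.sSup_le ?_ hC
  rintro r ⟨x, y, hxy, rfl⟩
  rw [div_le_iff₀ (dist_pos.2 hxy)]
  exact h x y

theorem norm_smul_le' (c : ℝ) (f : Lip0 M p) : ‖c • f‖ ≤ |c| * ‖f‖ := by
  refine norm_le_of_abs_sub_le _ (mul_nonneg (abs_nonneg c) (norm_nonneg' f)) fun x y => ?_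
  rw [smul_apply, smul_apply, ← mul_sub, abs_mul, mul_assoc]
  exact mul_le_mul_of_nonneg_left (abs_sub_le f x y) (abs_nonneg c)

theorem core : NormedSpace.Core ℝ (Lip0 M p) where
  norm_nonneg := norm_nonneg'
  norm_smul c f := by
    rw [Real.norm_eq_abs]
    refine le_antisymm (norm_smul_le' c f) ?_
    by_cases hc : c = 0
    · simpa [hc] using norm_nonneg' _
    · have h := norm_smul_le' c⁻¹ (c • f)
      rw [smul_smul, inv_mul_cancel₀ hc, one_smul, abs_inv] at h
      have hc' : 0 < |c| := abs_pos.2 hc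
      rwa [inv_mul_eq_div, le_div_iff₀ hc', mul_comm] at h
  norm_triangle f g := by
    refine norm_le_of_abs_sub_le _ (add_nonneg (norm_nonneg' f) (norm_nonneg' g)) fun x y => ?_
    rw [add_apply, add_apply, add_mul]
    calc |f x + g x - (f y + g y)| = |(f x - f y) + (g x - g y)| := by ring_nf
      _ ≤ |f x - f y| + |g x - g y| := abs_add_le _ _
      _ ≤ _ := add_le_add (abs_sub_le f x y) (abs_sub_le g x y)
  norm_eq_zero_iff f := by
    constructor
    · intro h
      apply Subtype.ext
      funext x
      have h1 := abs_sub_le f x p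
      rw [h, zero_mul, base_apply, sub_zero] at h1
      exact abs_nonpos_iff.1 h1
    · rintro rfl
      refine le_antisymm (norm_le_of_abs_sub_le _ le_rfl fun x y => ?_) (norm_nonneg' _)
      simp [zero_apply]

instance : NormedAddCommGroup (Lip0 M p) := NormedAddCommGroup.ofCore core

instance : NormedSpace ℝ (Lip0 M p) := NormedSpace.ofCore core

/-- The evaluation functional `δ_x : f ↦ f x`. -/
def delta (x : M) : StrongDual ℝ (Lip0 M p) :=
  LinearMap.mkContinuous
    { toFun := fun f => f x
      map_add' := fun f g => add_apply f g x
      map_smul' := fun c f => smul_apply c f x }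
    (dist x p) (fun f => by
      have h := abs_sub_le f x p
      rw [base_apply, sub_zero, mul_comm] at h
      exact h)

end Lip0

variable (M p)

/-- The Lipschitz-free space `F(M)`, the closed linear span of the evaluations `δ_x` in
`Lip_0(M)*`. It is the predual of `Lip_0(M)`, already in its canonical image in the dual. -/
def freeSpace : Submodule ℝ (StrongDual ℝ (Lip0 M p)) :=
  (Submodule.span ℝ (Set.range (Lip0.delta : M → StrongDual ℝ (Lip0 M p)))).topologicalClosure

/-- The weak* strong diameter 2 property of `Lip_0(M) = F(M)*`. -/
def HasWeakStarSD2P : Prop := SD2PFor (freeSpace M p : Set (StrongDual ℝ (Lip0 M p)))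

/-- The weak* symmetric strong diameter 2 property of `Lip_0(M) = F(M)*`. -/
def HasWeakStarSSD2P : Prop := SSD2PFor (freeSpace M p : Set (StrongDual ℝ (Lip0 M p)))

end Lip0

/-! ### Two explicit metric spaces with distances in `{0, 1, 2}` -/

open Classical in
/-- The metric in which distinct points are at distance 1 if they are related by `r` in one of the
two orders, and at distance 2 otherwise. -/
@[reducible] def oneTwoMetric {V : Type*} (r : V → V → Prop) : MetricSpace V where
  dist x y := if x = y then 0 else if r x y ∨ r y x then 1 else 2
  dist_self x := by simp
  dist_comm x y := by simp only [eq_comm, or_comm]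
  dist_triangle x y z := by
    by_cases hxy : x = y
    · subst hxy; simp
    · by_cases hyz : y = z
      · subst hyz; simp
      · simp only [hxy, hyz, if_false]
        split_ifs <;> norm_num
  eq_of_dist_eq_zero {x y} h := by
    by_contra hxy
    simp only [hxy, if_false] at h
    split_ifs at h <;> norm_num at h

/-- The points `a_1, a_2, b_1, b_2` and `u_m, v_m` for `m ∈ ℕ`. -/
inductive SpaceAB : Type
  | a (i : Fin 2) : SpaceAB
  | b (i : Fin 2) : SpaceAB
  | u (m : ℕ) : SpaceAB
  | v (m : ℕ) : SpaceAB

/-- The pairs of points at distance 1, each listed in one order. -/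
inductive SpaceAB.Near : SpaceAB → SpaceAB → Prop
  | ab (i j : Fin 2) : SpaceAB.Near (.a i) (.b j)
  | au (i : Fin 2) (m : ℕ) : SpaceAB.Near (.a i) (.u m)
  | bv (i : Fin 2) (m : ℕ) : SpaceAB.Near (.b i) (.v m)
  | uv (m : ℕ) : SpaceAB.Near (.u m) (.v m)

/-- `d(a_i, b_j) = d(a_i, u_m) = d(b_i, v_m) = d(u_m, v_m) = 1`, all other distances between
distinct points are 2. -/
instance : MetricSpace SpaceAB := oneTwoMetric SpaceAB.Near

/-- The points `a_i, u^i_m, v^i_m` for `i ∈ {1, 2, 3}` and `m ∈ ℕ`. -/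
inductive SpaceA : Type
  | a (i : Fin 3) : SpaceA
  | u (i : Fin 3) (m : ℕ) : SpaceA
  | v (i : Fin 3) (m : ℕ) : SpaceA

/-- The pairs of points at distance 1, each listed in one order. -/
inductive SpaceA.Near : SpaceA → SpaceA → Prop
  | au (i j : Fin 3) (m : ℕ) : i ≠ j → SpaceA.Near (.a i) (.u j m)
  | av (i j : Fin 3) (m : ℕ) : i ≠ j → SpaceA.Near (.a i) (.v j m)
  | uv (j : Fin 3) (m : ℕ) : SpaceA.Near (.u j m) (.v j m)

/-- `d(a_i, u^j_m) = d(a_i, v^j_m) = 1` for `i ≠ j` and `d(u^j_m, v^j_m) = 1`, all other distances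
between distinct points are 2. -/
instance : MetricSpace SpaceA := oneTwoMetric SpaceA.Near

end LipDiam

end

open Filter Topology

namespace LipDiam

/-! The positive results perturb a function `f` of the unit ball only at a pair `u m`, `v m`. As
distances are 1 or 2, the difference quotient there can be pushed to 1 or to -1 inside the ball once
`|f x - f y| ≤ 1` for all other neighbours `x` of `u m` and `y` of `v m`. The perturbations are
bounded with disjoint supports, hence weakly null; so two sequences in the ball tend weakly to `f`
while their terms are eventually 2 apart (`exists_tendsto_weak_pair`). In `SpaceAB` these neighbours
are some `a i` and `b j`, at distance 1, so one pair serves all functions at once: SD2P. In `SpaceA`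
they are the `a i` with `i ≠ k`; two of the three values `f (a i)` differ by at most 1, so a
suitable `k` exists, but it depends on `f`: D2P.

The negative results use slices of molecules at points at distance 2. In `SpaceAB`, the slices at `a
0, a 1` and `b 0, b 1` make `g` almost constant on all midpoints, which exhaust the space. In
`SpaceA`, the three slices at `a l, a (l + 1)` are averaged: for any two points, one slice keeps its
share of the difference quotient away from 2. -/

theorem exists_mem_Icc_of_forall_le {ι : Type*} (s : Set ι) (L R : ι → ℝ)
    (h : ∀ z ∈ s, ∀ w ∈ s, L z ≤ R w) : ∃ b, ∀ z ∈ s, L z ≤ b ∧ b ≤ R z := by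
  refine ⟨sSup (L '' s), fun z hz => ⟨le_csSup ⟨R z, ?_⟩ ⟨z, hz, rfl⟩, csSup_le ⟨_, z, hz, rfl⟩ ?_⟩⟩
  · rintro _ ⟨w, hw, rfl⟩
    exact h w hw z hz
  · rintro _ ⟨w, hw, rfl⟩
    exact h w hw z hz

/-! ### Lipschitz modification at two points -/

section Extension

variable {M : Type*} [MetricSpace M]

open Classical in
/-- A 1-Lipschitz function can be changed at two points `u`, `v` at distance 1 so that its
difference quotient there becomes 1, unless its values elsewhere forbid it. -/
theorem exists_lipschitz_modification {f : M → ℝ} (hf : ∀ x y, f x - f y ≤ dist x y) {u v : M}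
    (huv : dist u v = 1)
    (hgap : ∀ x y, x ≠ u → x ≠ v → y ≠ u → y ≠ v → f y - f x ≤ dist x u + dist y v - 1) :
    ∃ g : M → ℝ, (∀ x y, g x - g y ≤ dist x y) ∧ (∀ x, x ≠ u → x ≠ v → g x = f x) ∧
      g u - g v = 1 := by
  -- `b` is the new value at `v`, and `b + 1` that at `u`. Each other point confines `b` to an
  -- interval, and pairwise compatibility of the bounds suffices; only one of the four comparisons
  -- needs `hgap`.
  obtain ⟨b, hb⟩ := exists_mem_Icc_of_forall_le {z | z ≠ u ∧ z ≠ v}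
    (fun z => max (f z - dist z v) (f z - dist z u - 1))
    (fun z => min (f z + dist z v) (f z + dist z u - 1)) (by
      rintro z ⟨hzu, hzv⟩ w ⟨hwu, hwv⟩
      have h1 := hf z w
      have h2 := dist_triangle_right z w v
      have h3 := dist_triangle_right z w u
      have h4 := hgap w z hwu hwv hzu hzv
      have h5 := dist_triangle4 z u v w
      rw [huv, dist_comm v w] at h5
      refine max_le (le_min ?_ ?_) (le_min ?_ ?_) <;> linarith)
  have hvu : v ≠ u := by rintro rfl; simp at huv
  have key : ∀ z, z ≠ u → z ≠ v → f z - b ≤ dist z v ∧ f z - b - 1 ≤ dist z u ∧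
      b - f z ≤ dist z v ∧ b + 1 - f z ≤ dist z u := by
    intro z hzu hzv
    obtain ⟨h1, h2⟩ := hb z ⟨hzu, hzv⟩
    rw [max_le_iff] at h1
    rw [le_min_iff] at h2
    refine ⟨?_, ?_, ?_, ?_⟩ <;> linarith [h1.1, h1.2, h2.1, h2.2]
  refine ⟨fun x => if x = u then b + 1 else if x = v then b else f x, fun x y => ?_,
    fun x hxu hxv => by simp [hxu, hxv], by simp [hvu]⟩
  by_cases hxu : x = u
  · by_cases hyu : y = u
    · simp [hxu, hyu]
    · by_cases hyv : y = v
      · simp [hxu, hyv, hvu, huv]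
      · simpa [hxu, hyu, hyv, dist_comm u y] using (key y hyu hyv).2.2.2
  · by_cases hxv : x = v
    · by_cases hyu : y = u
      · simp only [hyu, hxv, hvu, if_true, if_false, dist_comm v u, huv]
        linarith
      · by_cases hyv : y = v
        · simp [hxv, hyv]
        · simpa [hxv, hvu, hyu, hyv, dist_comm v y] using (key y hyu hyv).2.2.1
    · by_cases hyu : y = u
      · have := (key x hxu hxv).2.1
        simp only [hxu, hxv, hyu, if_true, if_false]
        linarith
      · by_cases hyv : y = v
        · simpa [hxu, hxv, hyv, hvu] using (key x hxu hxv).1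
        · simpa [hxu, hxv, hyu, hyv] using hf x y

end Extension

/-! ### Weakly convergent perturbations -/

namespace Lip0

variable {M : Type*} [MetricSpace M] {p : M}

theorem sub_apply (f g : Lip0 M p) (x : M) : (f - g) x = f x - g x := map_sub (delta x) f g

theorem neg_apply (f : Lip0 M p) (x : M) : (-f) x = -f x := map_neg (delta x) f

theorem sum_apply {ι : Type*} (s : Finset ι) (f : ι → Lip0 M p) (x : M) :
    (∑ i ∈ s, f i) x = ∑ i ∈ s, f i x := map_sum (delta x) f s

theorem sub_le_dist {f : Lip0 M p} (hf : ‖f‖ ≤ 1) (x y : M) : f x - f y ≤ dist x y :=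
  (le_abs_self _).trans <| (abs_sub_le f x y).trans <| by
    simpa using mul_le_mul_of_nonneg_right hf (dist_nonneg (x := x) (y := y))

/-- The element of `Lip_0(M)` given by a 1-Lipschitz function vanishing at `p`. -/
def ofSubLeDist (g : M → ℝ) (hg : ∀ x y, g x - g y ≤ dist x y) (hp : g p = 0) : Lip0 M p :=
  ⟨g, hp, 1, LipschitzWith.of_dist_le_mul fun x y => by
    rw [NNReal.coe_one, one_mul, Real.dist_eq, abs_sub_le_iff]
    exact ⟨hg x y, dist_comm x y ▸ hg y x⟩⟩

theorem norm_le_of_sub_le {f : Lip0 M p} {C : ℝ} (hC : 0 ≤ C)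
    (h : ∀ x y, x ≠ y → f x - f y ≤ C * dist x y) : ‖f‖ ≤ C := by
  refine norm_le_of_abs_sub_le f hC fun x y => ?_
  rcases eq_or_ne x y with rfl | hxy
  · simp
  · exact abs_sub_le_iff.2 ⟨h x y hxy, dist_comm x y ▸ h y x hxy.symm⟩

theorem norm_ofSubLeDist_le (g : M → ℝ) (hg : ∀ x y, g x - g y ≤ dist x y) (hp : g p = 0) :
    ‖ofSubLeDist g hg hp‖ ≤ 1 :=
  norm_le_of_sub_le zero_le_one fun x y _ => by rw [one_mul]; exact hg x y

theorem norm_le_of_abs_le (hM : ∀ x y : M, x ≠ y → 1 ≤ dist x y) {f : Lip0 M p} {C : ℝ}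
    (h : ∀ x, |f x| ≤ C) : ‖f‖ ≤ 2 * C := by
  have hC : 0 ≤ C := (abs_nonneg _).trans (h p)
  refine norm_le_of_sub_le (by positivity) fun x y hxy => ?_
  have h1 := abs_le.1 (h x)
  have h2 := abs_le.1 (h y)
  nlinarith [hM x y hxy]

/-- Uniformly bounded functions with pairwise disjoint supports are weakly null in `Lip_0(M)` when
`M` is uniformly discrete. -/
theorem tendsto_zero_of_disjoint (hM : ∀ x y : M, x ≠ y → 1 ≤ dist x y) {h : ℕ → Lip0 M p} {C : ℝ}
    (hC : ∀ m x, |h m x| ≤ C) (hd : ∀ x m k, h m x ≠ 0 → h k x ≠ 0 → m = k)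
    (φ : StrongDual ℝ (Lip0 M p)) : Tendsto (fun m => φ (h m)) atTop (𝓝 0) := by
  have hC0 : 0 ≤ C := (abs_nonneg _).trans (hC 0 p)
  have hs : Summable fun m => |φ (h m)| := by
    refine summable_of_sum_le (c := ‖φ‖ * (2 * C)) (fun m => abs_nonneg _) fun F => ?_
    -- Attaching signs turns the sum of absolute values into one value of `φ`. Disjoint supports
    -- keep `g` bounded by `C`, uniformly in `F`.
    set g : Lip0 M p := ∑ m ∈ F, (SignType.sign (φ (h m)) : ℝ) • h m with hg
    have h1 : ∑ m ∈ F, |φ (h m)| = φ g := by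
      simp [hg, map_sum, sign_mul_self]
    have h2 : ‖g‖ ≤ 2 * C := by
      refine norm_le_of_abs_le hM fun x => ?_
      rw [hg, sum_apply]
      by_cases hx : ∃ k ∈ F, h k x ≠ 0
      · obtain ⟨k, hk, hkx⟩ := hx
        rw [Finset.sum_eq_single_of_mem k hk fun m _ hmk => ?_]
        · rw [smul_apply, abs_mul]
          refine (mul_le_of_le_one_left (abs_nonneg _) ?_).trans (hC k x)
          cases SignType.sign (φ (h k)) <;> simp
        · rw [smul_apply, not_not.1 fun hmx => hmk (hd x m k hmx hkx), mul_zero]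
      · push Not at hx
        rw [Finset.sum_eq_zero fun m hm => by rw [smul_apply, hx m hm, mul_zero]]
        simpa using hC0
    rw [h1]
    exact (le_abs_self _).trans <| (φ.le_opNorm g).trans <|
      mul_le_mul_of_nonneg_left h2 (norm_nonneg φ)
  exact (tendsto_zero_iff_abs_tendsto_zero _).2 hs.tendsto_atTop_zero

/-- In a space with distances in `[1, 2]`, let `u m`, `v m` be disjoint pairs of points at
distance 1. If the values of `f` away from these pairs permit it, then `f` is the weak limit of a
sequence in the unit ball whose members have difference quotient 1 at the respective pairs. -/
theorem exists_tendsto_weak (hM1 : ∀ x y : M, x ≠ y → 1 ≤ dist x y) (hM2 : ∀ x y : M, dist x y ≤ 2)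
    {u v : ℕ → M} (hu : u.Injective) (hv : v.Injective) (huv : ∀ m k, u m ≠ v k)
    (hd : ∀ m, dist (u m) (v m) = 1) {f : Lip0 M p} (hf : ‖f‖ ≤ 1)
    (hgap : ∀ m x y, x ≠ u m → x ≠ v m → y ≠ u m → y ≠ v m →
      f y - f x ≤ dist x (u m) + dist y (v m) - 1) :
    ∃ F : ℕ → Lip0 M p, (∀ m, ‖F m‖ ≤ 1) ∧
      (∀ φ : StrongDual ℝ (Lip0 M p), Tendsto (fun m => φ (F m)) atTop (𝓝 (φ f))) ∧
      ∀ᶠ m in atTop, F m (u m) - F m (v m) = 1 := by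
  have hF : ∀ m, ∃ g : Lip0 M p, ‖g‖ ≤ 1 ∧ (∀ x, x ≠ u m → x ≠ v m → g x = f x) ∧
      (u m ≠ p → v m ≠ p → g (u m) - g (v m) = 1) := by
    intro m
    -- Values at the base point must stay 0, so `f` is kept for the finitely many pairs that contain
    -- it.
    by_cases hp : u m ≠ p ∧ v m ≠ p
    · obtain ⟨g, hg1, hg2, hg3⟩ := exists_lipschitz_modification (sub_le_dist hf) (hd m) (hgap m)
      have hgp : g p = 0 := (hg2 p hp.1.symm hp.2.symm).trans (base_apply f)
      exact ⟨ofSubLeDist g hg1 hgp, norm_ofSubLeDist_le g hg1 hgp, hg2, fun _ _ => hg3⟩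
    · exact ⟨f, hf, fun _ _ _ => rfl, fun h1 h2 => absurd ⟨h1, h2⟩ hp⟩
  choose F hF1 hF2 hF3 using hF
  refine ⟨F, hF1, fun φ => ?_, ?_⟩
  · have habs : ∀ {g : Lip0 M p}, ‖g‖ ≤ 1 → ∀ x, |g x| ≤ 2 := fun {g} hg x => by
      have := abs_sub_le g x p
      rw [base_apply, sub_zero] at this
      nlinarith [hM2 x p, dist_nonneg (x := x) (y := p)]
    have hsupp : ∀ {m x}, (F m - f) x ≠ 0 → x = u m ∨ x = v m := fun {m x} hx => by
      by_contra! hne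
      exact hx (by rw [sub_apply, hF2 m x hne.1 hne.2, sub_self])
    have h0 := tendsto_zero_of_disjoint hM1 (h := fun m => F m - f) (C := 4)
      (fun m x => by
        rw [sub_apply]
        exact (abs_sub _ _).trans (by linarith [habs (hF1 m) x, habs hf x]))
      (fun x m k hm hk => by
        rcases hsupp hm with h1 | h1 <;> rcases hsupp hk with h2 | h2
        · exact hu (h1.symm.trans h2)
        · exact absurd (h1.symm.trans h2) (huv m k)
        · exact absurd (h2.symm.trans h1) (huv k m)
        · exact hv (h1.symm.trans h2)) φ
    simpa using h0.add_const (φ f)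
  · have hne : ∀ {w : ℕ → M}, w.Injective → ∀ᶠ m in atTop, w m ≠ p := fun hw =>
      Nat.cofinite_eq_atTop ▸ hw.tendsto_cofinite.eventually (eventually_cofinite_ne p)
    filter_upwards [hne hu, hne hv] with m h1 h2 using hF3 m h1 h2

end Lip0

/-! ### Diameters, slices and weak convergence -/

theorem diam_le_two_of_subset_closedBall {X : Type*} [NormedAddCommGroup X] {S : Set X}
    (hS : S ⊆ Metric.closedBall 0 1) : Metric.diam S ≤ 2 :=
  (Metric.diam_mono hS Metric.isBounded_closedBall).trans <| by
    simpa using Metric.diam_closedBall (x := (0 : X)) zero_le_one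

theorem diam_eq_two {X : Type*} [NormedAddCommGroup X] {S : Set X}
    (hS : S ⊆ Metric.closedBall 0 1) {x y : X} (hx : x ∈ S) (hy : y ∈ S) (hxy : 2 ≤ ‖x - y‖) :
    Metric.diam S = 2 :=
  (diam_le_two_of_subset_closedBall hS).antisymm <| hxy.trans <| dist_eq_norm x y ▸
    Metric.dist_le_diam_of_mem (Metric.isBounded_closedBall.subset hS) hx hy

section Slices

variable {X : Type*} [NormedAddCommGroup X] [NormedSpace ℝ X]

theorem IsSlice.mono {Z Z' : Set (StrongDual ℝ X)} (h : Z ⊆ Z') {S : Set X} (hS : IsSlice Z S) :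
    IsSlice Z' S :=
  hS.imp fun _ hφ => ⟨h hφ.1, hφ.2⟩

theorem SD2PFor.anti {Z Z' : Set (StrongDual ℝ X)} (h : Z ⊆ Z') (hZ : SD2PFor Z') : SD2PFor Z :=
  fun n w S hw hw1 hS => hZ n w S hw hw1 fun i => (hS i).mono h

theorem SSD2PFor.anti {Z Z' : Set (StrongDual ℝ X)} (h : Z ⊆ Z') (hZ : SSD2PFor Z') : SSD2PFor Z :=
  fun n S hn hS => hZ n S hn fun i => (hS i).mono h

theorem slice_nonempty {φ : StrongDual ℝ X} (hφ : ‖φ‖ = 1) {α : ℝ} (hα : 0 < α) :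
    (slice φ α).Nonempty := by
  obtain ⟨x, hx, hφx⟩ := φ.exists_lt_apply_of_lt_opNorm (r := 1 - α) (by rw [hφ]; linarith)
  rcases le_total 0 (φ x) with h | h
  · exact ⟨x, by simpa using hx.le, by rwa [Real.norm_of_nonneg h] at hφx⟩
  · exact ⟨-x, by simpa using hx.le, by rwa [Real.norm_of_nonpos h, ← map_neg] at hφx⟩

theorem convComb_subset_closedBall {n : ℕ} {w : Fin n → ℝ} {S : Fin n → Set X} (hw : ∀ i, 0 ≤ w i)
    (hw1 : ∑ i, w i = 1) (hS : ∀ i, S i ⊆ Metric.closedBall 0 1) :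
    convComb w S ⊆ Metric.closedBall 0 1 := by
  rintro _ ⟨y, hy, rfl⟩
  exact (convex_closedBall (0 : X) 1).sum_mem (fun i _ => hw i) hw1 fun i _ => hS i (hy i)

theorem SSD2PFor.sd2PFor {Z : Set (StrongDual ℝ X)} (hZ : SSD2PFor Z) : SD2PFor Z := by
  intro n w S hw hw1 hS
  have hn : 0 < n := by
    rcases Nat.eq_zero_or_pos n with rfl | hn
    · simp at hw1
    · exact hn
  have hSB : ∀ i, S i ⊆ Metric.closedBall 0 1 := fun i => by
    obtain ⟨φ, -, -, α, -, h⟩ := hS i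
    exact h ▸ fun _ hx => hx.1
  have hB := convComb_subset_closedBall hw hw1 hSB
  refine (diam_le_two_of_subset_closedBall hB).antisymm <| le_of_forall_pos_le_add fun ε hε => ?_
  -- The combinations of the `f i + g` and of the `f i - g` differ by `2 • g`, because the weights
  -- sum to 1.
  obtain ⟨f, g, -, -, hg, hfg⟩ := hZ n S hn hS (ε / 2) (by positivity)
  have h := Metric.dist_le_diam_of_mem (Metric.isBounded_closedBall.subset hB)
    (x := ∑ i, w i • (f i + g)) (y := ∑ i, w i • (f i - g))
    ⟨_, fun i => (hfg i).1, rfl⟩ ⟨_, fun i => (hfg i).2, rfl⟩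
  have h2 : ∑ i, w i • (f i + g) - ∑ i, w i • (f i - g) = (2 : ℝ) • g := by
    simp only [smul_add, smul_sub, Finset.sum_add_distrib, Finset.sum_sub_distrib,
      ← Finset.sum_smul, hw1]
    module
  rw [dist_eq_norm, h2, norm_smul, Real.norm_ofNat] at h
  linarith

theorem tendsto_toWeakSpace {ι : Type*} {l : Filter ι} {F : ι → X} {f : X}
    (h : ∀ φ : StrongDual ℝ X, Tendsto (fun i => φ (F i)) l (𝓝 (φ f))) :
    Tendsto (fun i => toWeakSpace ℝ X (F i)) l (𝓝 (toWeakSpace ℝ X f)) :=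
  (WeakBilin.tendsto_iff_forall_eval_tendsto (topDualPairing ℝ X).flip fun _ _ hxy =>
    (SeparatingDual.eq_iff_forall_dual_eq (R := ℝ)).2 fun φ => LinearMap.congr_fun hxy φ).2 h

end Slices

/-! ### Criteria for the D2P and the SD2P -/

namespace Lip0

variable {M : Type*} [MetricSpace M] {p : M}

theorem exists_tendsto_weak_pair (hM : ∀ x y : M, x ≠ y → dist x y = 1 ∨ dist x y = 2)
    {u v : ℕ → M} (hu : u.Injective) (hv : v.Injective) (huv : ∀ m k, u m ≠ v k)
    (hd : ∀ m, dist (u m) (v m) = 1) {f : Lip0 M p} (hf : ‖f‖ ≤ 1)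
    (hgap : ∀ m x y, x ≠ v m → y ≠ u m → dist x (u m) = 1 → dist y (v m) = 1 → |f x - f y| ≤ 1) :
    ∃ F G : ℕ → Lip0 M p, (∀ m, ‖F m‖ ≤ 1) ∧ (∀ m, ‖G m‖ ≤ 1) ∧
      (∀ φ : StrongDual ℝ (Lip0 M p), Tendsto (fun m => φ (F m)) atTop (𝓝 (φ f))) ∧
      (∀ φ : StrongDual ℝ (Lip0 M p), Tendsto (fun m => φ (G m)) atTop (𝓝 (φ f))) ∧
      ∀ᶠ m in atTop, F m (u m) - F m (v m) = 1 ∧ G m (u m) - G m (v m) = -1 := by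
  have hM1 : ∀ x y : M, x ≠ y → 1 ≤ dist x y := fun x y hxy => by
    rcases hM x y hxy with h | h <;> simp [h]
  have hM2 : ∀ x y : M, dist x y ≤ 2 := fun x y => by
    rcases eq_or_ne x y with rfl | hxy
    · simp
    · rcases hM x y hxy with h | h <;> simp [h]
  have hgap' : ∀ m x y, x ≠ u m → x ≠ v m → y ≠ u m → y ≠ v m →
      |f x - f y| ≤ dist x (u m) + dist y (v m) - 1 := by
    intro m x y hxu hxv hyu hyv
    have h2 : |f x - f y| ≤ 2 :=
      abs_sub_le_iff.2 ⟨(sub_le_dist hf x y).trans (hM2 _ _), (sub_le_dist hf y x).trans (hM2 _ _)⟩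
    rcases hM x (u m) hxu with h3 | h3
    · rcases hM y (v m) hyv with h4 | h4
      · linarith [hgap m x y hxv hyu h3 h4]
      · linarith
    · linarith [hM1 y (v m) hyv]
  obtain ⟨F, hF1, hF2, hF3⟩ := exists_tendsto_weak hM1 hM2 hu hv huv hd hf
    fun m x y h1 h2 h3 h4 => (abs_sub_le_iff.1 (hgap' m x y h1 h2 h3 h4)).2
  -- Quotient -1 for `f` is quotient 1 for `-f`; the gap condition is invariant under this sign
  -- change.
  obtain ⟨G, hG1, hG2, hG3⟩ := exists_tendsto_weak hM1 hM2 hu hv huv hd (f := -f)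
    (by rwa [norm_neg]) fun m x y h1 h2 h3 h4 => by
      rw [neg_apply, neg_apply]
      linarith [(abs_sub_le_iff.1 (hgap' m x y h1 h2 h3 h4)).1]
  refine ⟨F, fun m => -G m, hF1, fun m => by rw [norm_neg]; exact hG1 m, hF2, fun φ => ?_, ?_⟩
  · simpa using (hG2 φ).neg
  · filter_upwards [hF3, hG3] with m h1 h2
    refine ⟨h1, ?_⟩
    rw [neg_apply, neg_apply]
    linarith

theorem two_le_norm_sub {f g : Lip0 M p} {x y : M} (hxy : dist x y = 1)
    (h : (f x - f y) - (g x - g y) = 2) : 2 ≤ ‖f - g‖ := by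
  have h1 := abs_sub_le (f - g) x y
  rw [hxy, mul_one, sub_apply, sub_apply] at h1
  linarith [le_abs_self (f x - g x - (f y - g y))]

/-- Only one function has to be perturbed, so the pairs `u m`, `v m` may be chosen after `f`. -/
theorem hasD2P (hM : ∀ x y : M, x ≠ y → dist x y = 1 ∨ dist x y = 2)
    (hgap : ∀ f : Lip0 M p, ‖f‖ ≤ 1 → ∃ u v : ℕ → M, u.Injective ∧ v.Injective ∧
      (∀ m k, u m ≠ v k) ∧ (∀ m, dist (u m) (v m) = 1) ∧
      ∀ m x y, x ≠ v m → y ≠ u m → dist x (u m) = 1 → dist y (v m) = 1 → |f x - f y| ≤ 1) :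
    HasD2P (Lip0 M p) := by
  rintro U hU ⟨f, hfB, hfU⟩
  rw [mem_closedBall_zero_iff] at hfB
  obtain ⟨u, v, hu, hv, huv, hd, hg⟩ := hgap f hfB
  obtain ⟨F, G, hF, hG, hF', hG', hFG⟩ := exists_tendsto_weak_pair hM hu hv huv hd hfB hg
  have hU' := hU.mem_nhds hfU
  obtain ⟨m, h1, h2, h3, h4⟩ := (((tendsto_toWeakSpace hF').eventually hU').and
    (((tendsto_toWeakSpace hG').eventually hU').and hFG)).exists
  refine diam_eq_two Set.inter_subset_left (x := F m) (y := G m)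
    ⟨mem_closedBall_zero_iff.2 (hF m), h1⟩ ⟨mem_closedBall_zero_iff.2 (hG m), h2⟩
    (two_le_norm_sub (hd m) ?_)
  rw [h3, h4]
  norm_num

/-- The gap condition is put on the metric rather than on a function, so one pair works for all
slices. Each summand then changes by twice its weight at that common pair, and no cancellation
occurs. -/
theorem hasSD2P (hM : ∀ x y : M, x ≠ y → dist x y = 1 ∨ dist x y = 2)
    {u v : ℕ → M} (hu : u.Injective) (hv : v.Injective) (huv : ∀ m k, u m ≠ v k)
    (hd : ∀ m, dist (u m) (v m) = 1)
    (hgap : ∀ m x y, x ≠ v m → y ≠ u m → dist x (u m) = 1 → dist y (v m) = 1 → dist x y ≤ 1) :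
    HasSD2P (Lip0 M p) := by
  intro n w S hw hw1 hS
  choose φ _ hφ α hα hSα using hS
  obtain rfl : S = fun i => slice (φ i) (α i) := funext hSα
  choose f hf using fun i => slice_nonempty (hφ i) (hα i)
  have hfB : ∀ i, ‖f i‖ ≤ 1 := fun i => mem_closedBall_zero_iff.1 (hf i).1
  choose F G hF hG hF' hG' hFG using fun i =>
    exists_tendsto_weak_pair hM hu hv huv hd (hfB i) fun m x y h1 h2 h3 h4 =>
      have h := hgap m x y h1 h2 h3 h4
      abs_sub_le_iff.2 ⟨(sub_le_dist (hfB i) x y).trans h,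
        (sub_le_dist (hfB i) y x).trans (dist_comm x y ▸ h)⟩
  obtain ⟨m, hm⟩ := (eventually_all.2 fun i =>
    ((hF' i (φ i)).eventually (lt_mem_nhds (hf i).2)).and
      (((hG' i (φ i)).eventually (lt_mem_nhds (hf i).2)).and (hFG i))).exists
  refine diam_eq_two (convComb_subset_closedBall hw hw1 fun i _ hx => hx.1)
    ⟨fun i => F i m, fun i => ⟨mem_closedBall_zero_iff.2 (hF i m), (hm i).1⟩, rfl⟩
    ⟨fun i => G i m, fun i => ⟨mem_closedBall_zero_iff.2 (hG i m), (hm i).2.1⟩, rfl⟩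
    (two_le_norm_sub (hd m) ?_)
  simp only [sum_apply, smul_apply]
  rw [← Finset.sum_sub_distrib, ← Finset.sum_sub_distrib, ← Finset.sum_sub_distrib]
  calc ∑ i, (w i * F i m (u m) - w i * F i m (v m) - (w i * G i m (u m) - w i * G i m (v m)))
      = ∑ i, w i * 2 := Finset.sum_congr rfl fun i _ => by
        linear_combination w i * (hm i).2.2.1 - w i * (hm i).2.2.2
    _ = 2 := by rw [← Finset.sum_mul, hw1, one_mul]

/-! ### Molecules and their weak* slices -/

/-- The elementary molecule `(δ_x - δ_y) / d(x, y)`. -/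
noncomputable def molecule (x y : M) : StrongDual ℝ (Lip0 M p) := (dist x y)⁻¹ • (delta x - delta y)

theorem molecule_apply (x y : M) (f : Lip0 M p) :
    molecule x y f = (dist x y)⁻¹ * (f x - f y) := rfl

theorem molecule_mem_freeSpace (x y : M) : molecule x y ∈ freeSpace M p :=
  Submodule.le_topologicalClosure _ <| Submodule.smul_mem _ _ <|
    sub_mem (Submodule.subset_span ⟨x, rfl⟩) (Submodule.subset_span ⟨y, rfl⟩)

theorem norm_molecule {x y : M} (hxy : x ≠ y) : ‖(molecule x y : StrongDual ℝ (Lip0 M p))‖ = 1 := by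
  have hd := dist_pos.2 hxy
  refine le_antisymm (ContinuousLinearMap.opNorm_le_bound _ zero_le_one fun f => ?_) ?_
  · rw [molecule_apply, Real.norm_eq_abs, abs_mul, abs_inv, abs_of_pos hd, one_mul,
      inv_mul_le_iff₀ hd, mul_comm]
    exact abs_sub_le f x y
  · have hg : ∀ z w, (dist z y - dist p y) - (dist w y - dist p y) ≤ dist z w := fun z w => by
      linarith [dist_triangle z w y]
    -- The distance to `y`, shifted to vanish at `p`, attains the norm.
    have h := (molecule x y).le_opNorm_of_le
      (norm_ofSubLeDist_le (p := p) (fun z => dist z y - dist p y) hg (sub_self _))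
    have h1 : molecule x y (ofSubLeDist (p := p) (fun z => dist z y - dist p y) hg (sub_self _))
        = 1 := by
      rw [molecule_apply]
      change (dist x y)⁻¹ * ((dist x y - dist p y) - (dist y y - dist p y)) = 1
      rw [dist_self]
      field_simp
      ring
    rwa [h1, norm_one, mul_one] at h

theorem isSlice_molecule {x y : M} (hxy : x ≠ y) {α : ℝ} (hα : 0 < α) :
    IsSlice (freeSpace M p : Set (StrongDual ℝ (Lip0 M p))) (slice (molecule x y) α) :=
  ⟨_, molecule_mem_freeSpace x y, norm_molecule hxy, α, hα, rfl⟩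

theorem mem_slice_molecule {x y : M} (hxy : x ≠ y) {α : ℝ} {f : Lip0 M p} :
    f ∈ slice (molecule x y) α ↔ ‖f‖ ≤ 1 ∧ (1 - α) * dist x y < f x - f y := by
  rw [slice, Set.mem_ofPred_eq, mem_closedBall_zero_iff, molecule_apply,
    lt_inv_mul_iff₀' (dist_pos.2 hxy)]

end Lip0

theorem Lip0.sub_lt_of_mem_slice_molecule {M : Type*} [MetricSpace M] {p : M} {x y : M}
    (hxy : dist x y = 2) {α : ℝ} {f : Lip0 M p} (hf : f ∈ slice (Lip0.molecule x y) α) :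
    ‖f‖ ≤ 1 ∧ 2 - 2 * α < f x - f y := by
  have hne : x ≠ y := fun h => by rw [h, dist_self] at hxy; norm_num at hxy
  obtain ⟨h1, h2⟩ := (Lip0.mem_slice_molecule hne).1 hf
  exact ⟨h1, by rw [hxy] at h2; linarith⟩

/-- If `f` and `f ± g` all almost attain their norm at `x`, `y`, then `g` is almost constant
between `x` and any metric midpoint `z` of `x` and `y`. -/
theorem Lip0.abs_sub_lt_of_mem_slice_molecule {M : Type*} [MetricSpace M] {p : M} {x y z : M}
    (hxy : dist x y = 2) (hxz : dist x z = 1) (hzy : dist z y = 1) {α : ℝ} {f g : Lip0 M p}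
    (h1 : f + g ∈ slice (Lip0.molecule x y) α) (h2 : f - g ∈ slice (Lip0.molecule x y) α) :
    |g x - g z| < α := by
  obtain ⟨hn1, hs1⟩ := Lip0.sub_lt_of_mem_slice_molecule hxy h1
  obtain ⟨hn2, hs2⟩ := Lip0.sub_lt_of_mem_slice_molecule hxy h2
  -- Both halves of the path through `z` gain at most 1, so `f + g` and `f - g` each gain between `1
  -- - 2 * α` and 1 from `z` to `x`. Their gains differ by `2 * (g x - g z)`.
  have a1 := Lip0.sub_le_dist hn1 x z
  have a2 := Lip0.sub_le_dist hn1 z y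
  have a3 := Lip0.sub_le_dist hn2 x z
  have a4 := Lip0.sub_le_dist hn2 z y
  simp only [Lip0.add_apply, Lip0.sub_apply] at *
  rw [abs_lt]
  constructor <;> linarith

open Classical in
theorem oneTwoMetric_dist_eq_one_or_two {V : Type*} {r : V → V → Prop} {x y : V} (hxy : x ≠ y) :
    (oneTwoMetric r).dist x y = 1 ∨ (oneTwoMetric r).dist x y = 2 := by
  change (if x = y then (0 : ℝ) else if r x y ∨ r y x then 1 else 2) = 1 ∨
    (if x = y then (0 : ℝ) else if r x y ∨ r y x then 1 else 2) = 2
  rw [if_neg hxy]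
  split_ifs <;> simp

open Classical in
theorem oneTwoMetric_dist_eq_one_iff {V : Type*} {r : V → V → Prop} {x y : V} :
    (oneTwoMetric r).dist x y = 1 ↔ x ≠ y ∧ (r x y ∨ r y x) := by
  change (if x = y then (0 : ℝ) else if r x y ∨ r y x then 1 else 2) = 1 ↔ _
  split_ifs with h1 h2
  · simp [h1]
  · simpa [h1] using h2
  · simpa [h1] using h2

/-! ### The first space: SD2P without the `w*`-SSD2P -/

namespace SpaceAB

theorem dist_eq_one_or_two (x y : SpaceAB) (hxy : x ≠ y) : dist x y = 1 ∨ dist x y = 2 :=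
  oneTwoMetric_dist_eq_one_or_two hxy

theorem Near.dist_eq {x y : SpaceAB} (h : Near x y) : dist x y = 1 :=
  oneTwoMetric_dist_eq_one_iff.2 ⟨by cases h <;> simp, Or.inl h⟩

theorem near_of_dist_eq_one {x y : SpaceAB} (h : dist x y = 1) : Near x y ∨ Near y x :=
  (oneTwoMetric_dist_eq_one_iff.1 h).2

theorem dist_eq_two {x y : SpaceAB} (hxy : x ≠ y) (h : ¬ (Near x y ∨ Near y x)) : dist x y = 2 :=
  (dist_eq_one_or_two x y hxy).resolve_left fun h1 => h (near_of_dist_eq_one h1)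

theorem hasSD2P (p : SpaceAB) : HasSD2P (Lip0 SpaceAB p) := by
  refine Lip0.hasSD2P dist_eq_one_or_two (u := u) (v := v) (fun _ _ => by simp) (fun _ _ => by simp)
    (fun _ _ => by simp) (fun m => (Near.uv m).dist_eq) fun m x y hx hy hxu hyv => ?_
  rcases near_of_dist_eq_one hxu with h | h <;> cases h
  · rcases near_of_dist_eq_one hyv with h | h <;> cases h
    · exact (Near.ab _ _).dist_eq.le
    · exact absurd rfl hy
  · exact absurd rfl hx

theorem not_hasWeakStarSSD2P (p : SpaceAB) : ¬ HasWeakStarSSD2P SpaceAB p := by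
  intro H
  have haa : dist (a 0) (a 1) = 2 := dist_eq_two (by simp) (by rintro (h | h) <;> cases h)
  have hbb : dist (b 0) (b 1) = 2 := dist_eq_two (by simp) (by rintro (h | h) <;> cases h)
  obtain ⟨f, g, -, -, hg, hfg⟩ := H 2
    ![slice (Lip0.molecule (a 0) (a 1)) (1 / 12), slice (Lip0.molecule (b 0) (b 1)) (1 / 12)]
    two_pos (by
      rw [Fin.forall_fin_two]
      exact ⟨Lip0.isSlice_molecule (by simp) (by norm_num),
        Lip0.isSlice_molecule (by simp) (by norm_num)⟩) (1 / 2) (by norm_num)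
  rw [Fin.forall_fin_two] at hfg
  obtain ⟨⟨ha1, ha2⟩, hb1, hb2⟩ := hfg
  have hab : ∀ i j, dist (a i) (b j) = 1 := fun i j => (Near.ab i j).dist_eq
  have hA : ∀ z, dist (a 0) z = 1 → dist z (a 1) = 1 → |g (a 0) - g z| < 1 / 12 :=
    fun z h1 h2 => Lip0.abs_sub_lt_of_mem_slice_molecule haa h1 h2 ha1 ha2
  have hB : ∀ z, dist (b 0) z = 1 → dist z (b 1) = 1 → |g (b 0) - g z| < 1 / 12 :=
    fun z h1 h2 => Lip0.abs_sub_lt_of_mem_slice_molecule hbb h1 h2 hb1 hb2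
  -- `b 0` is a midpoint of `a 0` and `a 1`, which links the two families of midpoints.
  have hab0 := abs_lt.1 (hA (b 0) (hab 0 0) (dist_comm (b 0) (a 1) ▸ hab 1 0))
  have hclose : ∀ z, |g z - g (a 0)| ≤ 1 / 4 := by
    intro z
    -- The `b i` and `u m` are midpoints of the `a`-pair, the `a i` and `v m` of the `b`-pair.
    have key : |g (a 0) - g z| < 1 / 12 ∨ |g (b 0) - g z| < 1 / 12 := by
      cases z with
      | a i => exact .inr (hB _ (dist_comm (b 0) (a i) ▸ hab i 0) (hab i 1))
      | b i => exact .inl (hA _ (hab 0 i) (dist_comm (b i) (a 1) ▸ hab 1 i))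
      | u m => exact .inl (hA _ (Near.au 0 m).dist_eq
        (dist_comm (u m) (a 1) ▸ (Near.au 1 m).dist_eq))
      | v m => exact .inr (hB _ (Near.bv 0 m).dist_eq
        (dist_comm (v m) (b 1) ▸ (Near.bv 1 m).dist_eq))
    rw [abs_le]
    rcases key with h | h <;> rw [abs_lt] at h <;> constructor <;>
      linarith [h.1, h.2, hab0.1, hab0.2]
  have : ‖g‖ ≤ 1 / 2 := Lip0.norm_le_of_sub_le (by norm_num) fun x y hxy => by
    have h1 := abs_le.1 (hclose x)
    have h2 := abs_le.1 (hclose y)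
    rcases dist_eq_one_or_two x y hxy with h | h <;> rw [h] <;> linarith
  linarith

end SpaceAB

/-! ### The second space: D2P without the `w*`-SD2P -/

namespace SpaceA

theorem dist_eq_one_or_two (x y : SpaceA) (hxy : x ≠ y) : dist x y = 1 ∨ dist x y = 2 :=
  oneTwoMetric_dist_eq_one_or_two hxy

theorem Near.dist_eq {x y : SpaceA} (h : Near x y) : dist x y = 1 :=
  oneTwoMetric_dist_eq_one_iff.2 ⟨by cases h <;> simp, Or.inl h⟩

theorem near_of_dist_eq_one {x y : SpaceA} (h : dist x y = 1) : Near x y ∨ Near y x :=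
  (oneTwoMetric_dist_eq_one_iff.1 h).2

theorem dist_eq_two {x y : SpaceA} (hxy : x ≠ y) (h : ¬ (Near x y ∨ Near y x)) : dist x y = 2 :=
  (dist_eq_one_or_two x y hxy).resolve_left fun h1 => h (near_of_dist_eq_one h1)

theorem dist_a_a (i j : Fin 3) : dist (a i) (a j) = if i = j then 0 else 2 := by
  split_ifs with h
  · rw [h, dist_self]
  · exact dist_eq_two (by simpa using h) (by rintro (h | h) <;> cases h)

theorem dist_u_a (i j : Fin 3) (m : ℕ) : dist (u i m) (a j) = if i = j then 2 else 1 := by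
  split_ifs with h
  · refine dist_eq_two (by simp) ?_
    rintro (h' | h') <;> cases h'
    exact absurd h.symm ‹_›
  · rw [dist_comm]
    exact (Near.au j i m (Ne.symm h)).dist_eq

theorem dist_v_a (i j : Fin 3) (m : ℕ) : dist (v i m) (a j) = if i = j then 2 else 1 := by
  split_ifs with h
  · refine dist_eq_two (by simp) ?_
    rintro (h' | h') <;> cases h'
    exact absurd h.symm ‹_›
  · rw [dist_comm]
    exact (Near.av j i m (Ne.symm h)).dist_eq

/-- If all three gaps exceeded 1, the largest and smallest values would differ by more than 2. The
index `k` is the one left out of a close pair. -/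
theorem exists_abs_sub_le {r : Fin 3 → ℝ} (hr : ∀ i j, r i - r j ≤ 2) :
    ∃ k, ∀ i j, i ≠ k → j ≠ k → |r i - r j| ≤ 1 := by
  have key : ∀ k l m : Fin 3, (∀ i, i ≠ k → i = l ∨ i = m) → |r l - r m| ≤ 1 →
      ∀ i j, i ≠ k → j ≠ k → |r i - r j| ≤ 1 := by
    intro k l m hk hlm i j hi hj
    rcases hk i hi with rfl | rfl <;> rcases hk j hj with rfl | rfl
    · simp
    · exact hlm
    · rwa [abs_sub_comm]
    · simp
  by_contra! h
  have not_key : ∀ k l m : Fin 3, (∀ i, i ≠ k → i = l ∨ i = m) → 1 < |r l - r m| := by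
    intro k l m hk
    by_contra! hlm
    obtain ⟨i, j, hi, hj, hij⟩ := h k
    exact (key k l m hk hlm i j hi hj).not_gt hij
  have h0 := not_key 0 1 2 (by decide)
  have h1 := not_key 1 0 2 (by decide)
  have h2 := not_key 2 0 1 (by decide)
  rw [lt_abs] at h0 h1 h2
  rcases h0 with h0 | h0 <;> rcases h1 with h1 | h1 <;> rcases h2 with h2 | h2 <;>
    linarith [hr 0 1, hr 1 0, hr 0 2, hr 2 0, hr 1 2, hr 2 1]

theorem hasD2P (p : SpaceA) : HasD2P (Lip0 SpaceA p) := by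
  refine Lip0.hasD2P dist_eq_one_or_two fun f hf => ?_
  obtain ⟨k, hk⟩ := exists_abs_sub_le (r := fun i => f (a i)) fun i j => by
    have h := Lip0.sub_le_dist hf (a i) (a j)
    rw [dist_a_a] at h
    split_ifs at h <;> linarith
  refine ⟨u k, v k, fun _ _ => by simp, fun _ _ => by simp, fun _ _ => by simp,
    fun m => (Near.uv k m).dist_eq, fun m x y hx hy hxu hyv => ?_⟩
  rcases near_of_dist_eq_one hxu with h | h <;> cases h
  · rcases near_of_dist_eq_one hyv with h | h <;> cases h
    · exact hk _ _ ‹_› ‹_›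
    · exact absurd rfl hy
  · exact absurd rfl hx

/-- The sum of the distances of `x` to `a_l` and to its cyclic successor. -/
noncomputable def pairDist (l : Fin 3) (x : SpaceA) : ℝ := dist x (a l) + dist x (a (l + 1))

theorem cyclic_cases : ∀ l i : Fin 3, (i = l ∧ i ≠ l + 1 ∧ i ≠ l + 2) ∨
    (i ≠ l ∧ i = l + 1 ∧ i ≠ l + 2) ∨ (i ≠ l ∧ i ≠ l + 1 ∧ i = l + 2) := by
  decide

theorem pairDist_a (l i : Fin 3) : pairDist l (a i) = if i = l + 2 then 4 else 2 := by
  rw [pairDist, dist_a_a, dist_a_a]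
  rcases cyclic_cases l i with ⟨h1, h2, h3⟩ | ⟨h1, h2, h3⟩ | ⟨h1, h2, h3⟩
  · rw [if_pos h1, if_neg h2, if_neg h3]; norm_num
  · rw [if_neg h1, if_pos h2, if_neg h3]; norm_num
  · rw [if_neg h1, if_neg h2, if_pos h3]; norm_num

theorem pairDist_u (l i : Fin 3) (m : ℕ) : pairDist l (u i m) = if i = l + 2 then 2 else 3 := by
  rw [pairDist, dist_u_a, dist_u_a]
  rcases cyclic_cases l i with ⟨h1, h2, h3⟩ | ⟨h1, h2, h3⟩ | ⟨h1, h2, h3⟩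
  · rw [if_pos h1, if_neg h2, if_neg h3]; norm_num
  · rw [if_neg h1, if_pos h2, if_neg h3]; norm_num
  · rw [if_neg h1, if_neg h2, if_pos h3]; norm_num

theorem pairDist_v (l i : Fin 3) (m : ℕ) : pairDist l (v i m) = if i = l + 2 then 2 else 3 := by
  rw [pairDist, dist_v_a, dist_v_a]
  rcases cyclic_cases l i with ⟨h1, h2, h3⟩ | ⟨h1, h2, h3⟩ | ⟨h1, h2, h3⟩
  · rw [if_pos h1, if_neg h2, if_neg h3]; norm_num
  · rw [if_neg h1, if_pos h2, if_neg h3]; norm_num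
  · rw [if_neg h1, if_neg h2, if_pos h3]; norm_num

/-- Take `l = j + 1`, so that the cyclic pair `l, l + 1` misses the superscript `j`; both points
then have the minimal `pairDist` 2. -/
theorem exists_pairDist_add_eq_of_near {x y : SpaceA} (h : Near x y) :
    ∃ l, pairDist l x + pairDist l y = 4 := by
  have hcyc : ∀ j : Fin 3, j + 1 + 2 = j := by decide
  cases h with
  | au i j m hij => exact ⟨j + 1, by rw [pairDist_a, pairDist_u, hcyc, if_neg hij]; norm_num⟩
  | av i j m hij => exact ⟨j + 1, by rw [pairDist_a, pairDist_v, hcyc, if_neg hij]; norm_num⟩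
  | uv j m => exact ⟨j + 1, by rw [pairDist_u, pairDist_v, hcyc]; norm_num⟩

theorem pairDist_le (l : Fin 3) (x : SpaceA) : x = a (l + 2) ∧ pairDist l x = 4 ∨
    pairDist l x ≤ 3 := by
  cases x with
  | a i => rw [pairDist_a]; split_ifs with h <;> norm_num [h]
  | u i m => rw [pairDist_u]; split_ifs <;> norm_num
  | v i m => rw [pairDist_v]; split_ifs <;> norm_num

/-- At distance 2 any `l` would do: only one point has `pairDist` 4, so the sum is at most 7, which
makes the constant `7 / 4` sharp here. -/
theorem exists_pairDist_add_le {x y : SpaceA} (hxy : x ≠ y) :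
    ∃ l, pairDist l x + pairDist l y - 7 / 2 ≤ 7 / 4 * dist x y := by
  rcases dist_eq_one_or_two x y hxy with h | h <;> rw [h]
  · rcases near_of_dist_eq_one h with h | h <;>
      obtain ⟨l, hl⟩ := exists_pairDist_add_eq_of_near h <;> exact ⟨l, by linarith⟩
  · refine ⟨0, ?_⟩
    rcases pairDist_le 0 x with ⟨hx, hx'⟩ | hx <;> rcases pairDist_le 0 y with ⟨hy, hy'⟩ | hy
    · exact absurd (hx.trans hy.symm) hxy
    all_goals linarith

/-- Being in the slice traps `f x - f (a (l + 1))` between `7 / 4 - dist x (a l)` and `dist x (a (l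
+ 1))`, and likewise for `g`; the bound is the length of this interval. -/
theorem abs_osc_le {p : SpaceA} {l : Fin 3} {f g : Lip0 SpaceA p}
    (hf : f ∈ slice (Lip0.molecule (a l) (a (l + 1))) (1 / 8))
    (hg : g ∈ slice (Lip0.molecule (a l) (a (l + 1))) (1 / 8)) (x : SpaceA) :
    |(f x - f (a (l + 1))) - (g x - g (a (l + 1)))| ≤ pairDist l x - 7 / 4 := by
  have hd : dist (a l) (a (l + 1)) = 2 := by rw [dist_a_a, if_neg (by simp)]
  obtain ⟨hf1, hf2⟩ := Lip0.sub_lt_of_mem_slice_molecule hd hf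
  obtain ⟨hg1, hg2⟩ := Lip0.sub_lt_of_mem_slice_molecule hd hg
  have h1 := Lip0.sub_le_dist hf1 (a l) x
  have h2 := Lip0.sub_le_dist hf1 x (a (l + 1))
  have h3 := Lip0.sub_le_dist hg1 (a l) x
  have h4 := Lip0.sub_le_dist hg1 x (a (l + 1))
  rw [dist_comm (a l) x] at h1 h3
  rw [pairDist, abs_le]
  constructor <;> linarith

theorem not_hasWeakStarSD2P (p : SpaceA) : ¬ HasWeakStarSD2P SpaceA p := by
  intro H
  have h2 := H 3 (fun _ => 1 / 3) (fun l => slice (Lip0.molecule (a l) (a (l + 1))) (1 / 8))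
    (fun _ => by norm_num) (by norm_num) fun l => Lip0.isSlice_molecule (by simp) (by norm_num)
  -- For each two points, one of the three slices contributes at most `7 / 4` and the others at most
  -- 2, and `(2 + 2 + 7 / 4) / 3 = 23 / 12`.
  suffices h : Metric.diam (convComb (fun _ => 1 / 3) fun l : Fin 3 =>
      slice (Lip0.molecule (a l) (a (l + 1)) : StrongDual ℝ (Lip0 SpaceA p)) (1 / 8)) ≤ 23 / 12 by
    rw [h2] at h
    norm_num at h
  refine Metric.diam_le_of_forall_dist_le (by norm_num) ?_
  rintro _ ⟨f, hf, rfl⟩ _ ⟨g, hg, rfl⟩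
  rw [dist_eq_norm]
  refine Lip0.norm_le_of_sub_le (by norm_num) fun x y hxy => ?_
  have hosc : ∀ l, (f l x - f l y) - (g l x - g l y) ≤ pairDist l x + pairDist l y - 7 / 2 :=
    fun l => by
      have hx := abs_le.1 (abs_osc_le (hf l) (hg l) x)
      have hy := abs_le.1 (abs_osc_le (hf l) (hg l) y)
      linarith [hx.2, hy.1]
  have htriv : ∀ l, (f l x - f l y) - (g l x - g l y) ≤ 2 * dist x y := fun l => by
    have hx := Lip0.sub_le_dist (mem_closedBall_zero_iff.1 (hf l).1) x y
    have hy := Lip0.sub_le_dist (mem_closedBall_zero_iff.1 (hg l).1) y x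
    rw [dist_comm y x] at hy
    linarith
  obtain ⟨l, hl⟩ := exists_pairDist_add_le hxy
  have hl' := (hosc l).trans hl
  simp only [Lip0.sub_apply, Lip0.sum_apply, Lip0.smul_apply]
  simp only [Fin.sum_univ_three]
  have h0 := htriv 0
  have h1 := htriv 1
  have h2 := htriv 2
  fin_cases l <;> simp only [Fin.zero_eta, Fin.mk_one, Fin.reduceFinMk] at hl' <;> linarith

end SpaceA

end LipDiam

theorem theorem1p3 :
    (∀ p : LipDiam.SpaceAB,
      LipDiam.HasSD2P (LipDiam.Lip0 LipDiam.SpaceAB p) ∧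
        ¬ LipDiam.HasWeakStarSSD2P LipDiam.SpaceAB p ∧
        ¬ LipDiam.HasSSD2P (LipDiam.Lip0 LipDiam.SpaceAB p)) ∧
    (∀ p : LipDiam.SpaceA,
      LipDiam.HasD2P (LipDiam.Lip0 LipDiam.SpaceA p) ∧
        ¬ LipDiam.HasWeakStarSD2P LipDiam.SpaceA p ∧
        ¬ LipDiam.HasSD2P (LipDiam.Lip0 LipDiam.SpaceA p) ∧
        ¬ LipDiam.HasSSD2P (LipDiam.Lip0 LipDiam.SpaceA p)) := 
  ⟨fun p => ⟨LipDiam.SpaceAB.hasSD2P p, LipDiam.SpaceAB.not_hasWeakStarSSD2P p,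
      fun h => LipDiam.SpaceAB.not_hasWeakStarSSD2P p (h.anti (Set.subset_univ _))⟩,
    fun p => ⟨LipDiam.SpaceA.hasD2P p, LipDiam.SpaceA.not_hasWeakStarSD2P p,
      fun h => LipDiam.SpaceA.not_hasWeakStarSD2P p (h.anti (Set.subset_univ _)),
      fun h => LipDiam.SpaceA.not_hasWeakStarSD2P p (h.sd2PFor.anti (Set.subset_univ _))⟩⟩
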